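/- Let $\mu_1,\mu_2$ be faithful states on $\mathbb{R}[x]$ (linear functionals with $\mu_i[1]=1$, $\mu_i[P^2]\ge 0$, and $\mu_i[P^2]=0$ only for $P=0$), with monic orthogonal polynomials $P^{(i)}_n$ satisfying $$x P^{(i)}_n = P^{(i)}_{n+1}+\beta^{(i)}_n P^{(i)}_n+\gamma^{(i)}_n P^{(i)}_{n-1},\qquad \gamma^{(i)}_0=0 .$$ Regard words in the letters $\{1,2\}$ as the vertices of the binary tree, with the empty word $\emptyset$ as root and the words $(i,u)$, $i=1,2$, as the children of $u$. Let $\Omega$ be a set of words that contains every postfix of each of its elements, contains all constant words $1^n,2^n$ ($n\ge1$), and is such that whenever $u\in\Omega$, $u(1)=i$, $j\ne i$ and $(j,u)\in\Omega$, also $(i,u)\in\Omega$. Put $\partial\Omega=\{u\in\Omega: u(1)=i,\ (i,u)\notin\Omega\}$. For $u\in\Omega$ let $P_u\in\mathbb{R}\langle x_1,x_2\rangle$ be the product, in order, of the polynomials $P^{(i)}_k(x_i)$ over the maximal constant blocks $i^k$ of $u$; for $u\notin\Omega$ write $u=(v,w)$ with $w$ the longest postfix of $u$ in $\Omega$ and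 let $P_u=x_vP_w$, where $x_v=x_{v(1)}\cdots x_{v(n)}$ for a word $v=(v(1),\dots,v(n))$. The product-type state $\phi_\Omega$ is the linear functional on $\mathbb{R}\langle x_1,x_2\rangle$ with $\phi_\Omega[1]=1$ and $\phi_\Omega[P_u]=0$ for all $u\neq\emptyset$. Its moment generating function is the formal power series in non-commuting variables $$M(z_1,z_2)=\sum_{w}\phi_\Omega[x_w]\,z_w .$$ Then $M$ has a scalar branched continued fraction expansion whose branching follows $\Omega$: $M=F_\emptyset$, where for each vertex $u$ $$F_u=\frac{1}{1-\sum_{i\,:\,(i,u)\in\Omega}E_{(i,u)}},$$ and the entry at the word $(i,u)=i^kv\in\Omega$ ($k\ge1$, $v$ empty or $v(1)\ne i$) is $$E_{i^kv}=\beta^{(i)}_{k-1}z_i+\frac{\gamma^{(i)}_k\, z_i\,|\,z_i}{1-\cdots}:=\beta^{(i)}_{k-1}z_i+\gamma^{(i)}_k\, z_i\,F_{i^kv}\,z_i\quad\text{if } i^kv\in\Omega\setminus\partial\Omega,$$ $$E_{i^kv}=\beta^{(i)}_{k-1}z_i\quad\text{if } i^kv\in\partial\Omega .$$ The infinite fraction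 is understood formally: if it is truncated after $n$ levels (that is, $F^{(0)}_u=0$, and $F^{(n+1)}_u$ is given by the formulas above with $F^{(n)}$ in place of $F$ in the entries), then all denominators are invertible formal power series and, for each word $w$, the coefficient of $z_w$ in $F^{(n)}_\emptyset$ equals $\phi_\Omega[x_w]$ for all sufficiently large $n$. -/

import Mathlib

open Polynomial

/-! ### Formal power series in non-commuting variables -/

/-- Formal power series in non-commuting variables `z_i`, `i : σ`, with coefficients in `R`:
the series `∑_w f(w) z_w` is its coefficient function `f` on words. -/
def NCPowerSeries (σ R : Type*) : Type _ := List σ → R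

namespace NCPowerSeries

variable {σ R : Type*} [Ring R]

/-- The coefficient of `z_w`. -/
def coeff (w : List σ) (f : NCPowerSeries σ R) : R := f w

instance : AddCommGroup (NCPowerSeries σ R) := inferInstanceAs (AddCommGroup (List σ → R))

instance : Module R (NCPowerSeries σ R) := inferInstanceAs (Module R (List σ → R))

/-- The product determined by `z_u * z_v = z_{uv}`. -/
instance : Mul (NCPowerSeries σ R) :=
  ⟨fun f g w => ∑ k ∈ Finset.range (w.length + 1), f (w.take k) * g (w.drop k)⟩

instance : One (NCPowerSeries σ R) := ⟨fun w => if w.length = 0 then 1 else 0⟩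

theorem mul_nil (f g : NCPowerSeries σ R) : (f * g) [] = f [] * g [] := by
  change ∑ k ∈ Finset.range _, _ = _
  simp

/-- The series `∑_v f(a v) z_v`. -/
def leftQuot (a : σ) (f : NCPowerSeries σ R) : NCPowerSeries σ R := fun v => f (a :: v)

theorem mul_cons (f g : NCPowerSeries σ R) (a : σ) (w : List σ) :
    (f * g) (a :: w) =
      f [] * g (a :: w) + (leftQuot a f * g) w := by
  change ∑ k ∈ Finset.range _, _ = _ + ∑ k ∈ Finset.range _, _
  rw [List.length_cons, Finset.sum_range_succ']
  simp [add_comm, leftQuot]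

theorem add_apply (f g : NCPowerSeries σ R) (w : List σ) : (f + g) w = f w + g w := rfl

protected theorem left_distrib' (f g h : NCPowerSeries σ R) : f * (g + h) = f * g + f * h := by
  funext w
  change ∑ k ∈ Finset.range _, f _ * (g _ + h _) =
    ∑ k ∈ Finset.range _, _ + ∑ k ∈ Finset.range _, _
  simp [mul_add, Finset.sum_add_distrib]

protected theorem right_distrib' (f g h : NCPowerSeries σ R) : (f + g) * h = f * h + g * h := by
  funext w
  change ∑ k ∈ Finset.range _, (f _ + g _) * h _ =
    ∑ k ∈ Finset.range _, _ + ∑ k ∈ Finset.range _, _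
  simp [add_mul, Finset.sum_add_distrib]

protected theorem smul_mul' (c : R) (f g : NCPowerSeries σ R) (w : List σ) :
    ((c • f) * g) w = c * (f * g) w := by
  change ∑ k ∈ Finset.range _, (c * f _) * _ = _ * ∑ k ∈ Finset.range _, _
  simp [Finset.mul_sum, mul_assoc]

protected theorem mul_assoc' (f g h : NCPowerSeries σ R) : f * g * h = f * (g * h) := by
  funext w
  induction w generalizing f with
  | nil => simp [mul_nil, mul_assoc]
  | cons a w ih =>
    have hd : leftQuot a (f * g) = f [] • leftQuot a g + leftQuot a f * g := by
      funext v
      exact mul_cons f g a v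
    rw [mul_cons, mul_cons f, hd, NCPowerSeries.right_distrib', add_apply, ih,
      mul_cons g h a w, mul_nil]
    rw [NCPowerSeries.smul_mul', mul_add, mul_assoc, add_assoc]

instance : Ring (NCPowerSeries σ R) :=
  { (inferInstance : AddCommGroup (NCPowerSeries σ R)),
    (inferInstance : Mul (NCPowerSeries σ R)),
    (inferInstance : One (NCPowerSeries σ R)) with
    left_distrib := NCPowerSeries.left_distrib'
    right_distrib := NCPowerSeries.right_distrib'
    mul_assoc := NCPowerSeries.mul_assoc'
    zero_mul := fun f => by
      funext w
      change ∑ k ∈ Finset.range _, (0 : R) * _ = 0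
      simp
    mul_zero := fun f => by
      funext w
      change ∑ k ∈ Finset.range _, _ * (0 : R) = 0
      simp
    one_mul := fun f => by
      funext w
      change ∑ k ∈ Finset.range _, (if (w.take k).length = 0 then (1 : R) else 0) * f (w.drop k) = _
      rw [Finset.sum_range_succ']
      have h : ∀ k ∈ Finset.range w.length,
          (if (w.take (k + 1)).length = 0 then (1 : R) else 0) * f (w.drop (k + 1)) = 0 := by
        intro k hk
        rw [Finset.mem_range] at hk
        rw [if_neg (by rw [List.length_take]; omega), zero_mul]
      rw [Finset.sum_eq_zero h]
      simp
    mul_one := fun f => by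
      funext w
      change ∑ k ∈ Finset.range _, f (w.take k) * (if (w.drop k).length = 0 then (1 : R) else 0) = _
      rw [Finset.sum_range_succ]
      have h : ∀ k ∈ Finset.range w.length,
          f (w.take k) * (if (w.drop k).length = 0 then (1 : R) else 0) = 0 := by
        intro k hk
        rw [Finset.mem_range] at hk
        rw [if_neg (by rw [List.length_drop]; omega), mul_zero]
      rw [Finset.sum_eq_zero h]
      simp }

open Classical in
/-- The variable `z_i`. -/
noncomputable def var (i : σ) : NCPowerSeries σ R := fun w => if w = [i] then 1 else 0

end NCPowerSeries

/-! ### One-variable states and their monic orthogonal polynomials -/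

/-- A state on `ℝ[x]`: a positive linear functional taking `1` to `1`. -/
def IsPolyState (μ : ℝ[X] →ₗ[ℝ] ℝ) : Prop := μ 1 = 1 ∧ ∀ p : ℝ[X], 0 ≤ μ (p * p)

/-- Faithfulness of a state on `ℝ[x]`. -/
def IsFaithfulPoly (μ : ℝ[X] →ₗ[ℝ] ℝ) : Prop := ∀ p : ℝ[X], μ (p * p) = 0 → p = 0

/-- The monic orthogonal polynomials of `μ`, by Gram-Schmidt without normalization applied to
`1, x, x², …`. -/
noncomputable def monicOP (μ : ℝ[X] →ₗ[ℝ] ℝ) (n : ℕ) : ℝ[X] :=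
  X ^ n - ∑ k : Fin n, C (μ (X ^ n * monicOP μ k) / μ (monicOP μ k * monicOP μ k)) * monicOP μ k
termination_by n
decreasing_by exact k.2

/-- The coefficients `β_n` in `x P_n = P_{n+1} + β_n P_n + γ_n P_{n-1}`;
see `monicOP_recursion`. -/
noncomputable def jacobiBeta (μ : ℝ[X] →ₗ[ℝ] ℝ) (n : ℕ) : ℝ :=
  μ (X * monicOP μ n * monicOP μ n) / μ (monicOP μ n * monicOP μ n)

/-- The coefficients `γ_n`, `n ≥ 1`, in `x P_n = P_{n+1} + β_n P_n + γ_n P_{n-1}`; `γ_0 = 0`. -/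
noncomputable def jacobiGamma (μ : ℝ[X] →ₗ[ℝ] ℝ) : ℕ → ℝ
  | 0 => 0
  | n + 1 => μ (monicOP μ (n + 1) * monicOP μ (n + 1)) / μ (monicOP μ n * monicOP μ n)

theorem degree_C_mul_le' (a : ℝ) (p : ℝ[X]) : (C a * p).degree ≤ p.degree := by
  rw [← smul_eq_C_mul]; exact degree_smul_le a p

theorem monicOP_degree_sub (μ : ℝ[X] →ₗ[ℝ] ℝ) (n : ℕ) :
    (monicOP μ n - X ^ n).degree < (n : WithBot ℕ) ∧ (monicOP μ n).degree = n := by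
  induction n using Nat.strong_induction_on with
  | _ n ih =>
    have h1 : (monicOP μ n - X ^ n).degree < (n : WithBot ℕ) := by
      rw [monicOP, sub_sub_cancel_left, degree_neg]
      refine (degree_sum_le _ _).trans_lt ?_
      rw [Finset.sup_lt_iff (by exact WithBot.bot_lt_coe n)]
      intro k _
      refine (degree_C_mul_le' _ _).trans_lt ?_
      rw [(ih k k.2).2]
      exact_mod_cast k.2
    refine ⟨h1, ?_⟩
    have h2 : monicOP μ n = X ^ n + (monicOP μ n - X ^ n) := by ring
    rw [h2, degree_add_eq_left_of_degree_lt, degree_X_pow]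
    rwa [degree_X_pow]

theorem monicOP_monic (μ : ℝ[X] →ₗ[ℝ] ℝ) (n : ℕ) : (monicOP μ n).Monic := by
  have h2 : monicOP μ n = X ^ n + (monicOP μ n - X ^ n) := by ring
  rw [h2]
  exact monic_X_pow_add (monicOP_degree_sub μ n).1

theorem monicOP_zero (μ : ℝ[X] →ₗ[ℝ] ℝ) : monicOP μ 0 = 1 := by
  rw [monicOP]; simp

theorem monicOP_orthogonal {μ : ℝ[X] →ₗ[ℝ] ℝ} (hμ : IsFaithfulPoly μ) {m n : ℕ} (h : m ≠ n) :
    μ (monicOP μ m * monicOP μ n) = 0 := by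
  have key : ∀ n m : ℕ, m < n → μ (monicOP μ n * monicOP μ m) = 0 := by
    intro n
    induction n using Nat.strong_induction_on with
    | _ n ih =>
      intro m hm
      have hne : μ (monicOP μ m * monicOP μ m) ≠ 0 :=
        fun h0 => (monicOP_monic μ m).ne_zero (hμ _ h0)
      rw [monicOP, sub_mul, map_sub, Finset.sum_mul, map_sum,
        Finset.sum_eq_single (⟨m, hm⟩ : Fin n)]
      · simp only [← smul_eq_C_mul, smul_mul_assoc, map_smul, smul_eq_mul]
        field_simp
        ring
      · intro k _ hk
        have hk' : (k : ℕ) ≠ m := fun e => hk (Fin.ext e)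
        rw [mul_assoc, ← smul_eq_C_mul, map_smul]
        rcases lt_or_gt_of_ne hk' with hlt | hlt
        · rw [mul_comm (monicOP μ k) (monicOP μ m), ih m hm k hlt, smul_zero]
        · rw [ih k k.2 m hlt, smul_zero]
      · simp
  rcases lt_or_gt_of_ne h with h | h
  · rw [mul_comm]; exact key _ _ h
  · exact key _ _ h

theorem monicOP_expand (μ : ℝ[X] →ₗ[ℝ] ℝ) (r : ℝ[X]) (n : ℕ)
    (h : ∀ k < n, μ (r * monicOP μ k) = 0) (q : ℝ[X]) (hq : q.degree < (n : WithBot ℕ)) : μ (r * q) = 0 := by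
  induction n generalizing q with
  | zero =>
    have : q = 0 := by
      rw [← degree_eq_bot]
      simpa using hq
    simp [this]
  | succ n ih =>
    have hd : (q - C (q.coeff n) * monicOP μ n).degree < (n : WithBot ℕ) := by
      rw [degree_lt_iff_coeff_zero] at hq ⊢
      intro m hm
      rcases hm.eq_or_lt with rfl | hm
      · have := monicOP_monic μ n
        rw [Monic, leadingCoeff, natDegree_eq_of_degree_eq_some (monicOP_degree_sub μ n).2] at this
        rw [coeff_sub, coeff_C_mul, this]; ring
      · rw [coeff_sub, coeff_C_mul, hq m hm, coeff_eq_zero_of_degree_lt (n := m)]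
        · simp
        · rw [(monicOP_degree_sub μ n).2]; exact_mod_cast hm
    have h1 := ih (fun k hk => h k (by omega)) _ hd
    have h2 := h n (by omega)
    have e : r * q = r * (q - C (q.coeff n) * monicOP μ n) + q.coeff n • (r * monicOP μ n) := by
      rw [smul_eq_C_mul]; ring
    rw [e, map_add, h1, map_smul, h2]; simp

/-- The three-term recursion, with `γ_0 = 0` (so that the last term is absent for `n = 0`). -/
theorem monicOP_recursion {μ : ℝ[X] →ₗ[ℝ] ℝ} (hμ : IsFaithfulPoly μ) (n : ℕ) :
    X * monicOP μ n = monicOP μ (n + 1) + C (jacobiBeta μ n) * monicOP μ n +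
      C (jacobiGamma μ n) * monicOP μ (n - 1) := by
  have hne : ∀ m, μ (monicOP μ m * monicOP μ m) ≠ 0 :=
    fun m h0 => (monicOP_monic μ m).ne_zero (hμ _ h0)
  have orth : ∀ (m : ℕ) (q : ℝ[X]), q.degree < (m : WithBot ℕ) → μ (monicOP μ m * q) = 0 := fun m q hq =>
    monicOP_expand μ _ m (fun k hk => monicOP_orthogonal hμ hk.ne') q hq
  have dXsub : ∀ m, (X * monicOP μ m - monicOP μ (m + 1)).degree < ((m + 1 : ℕ) : WithBot ℕ) := by
    intro m
    have e : X * monicOP μ m - monicOP μ (m + 1) =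
        X * (monicOP μ m - X ^ m) - (monicOP μ (m + 1) - X ^ (m + 1)) := by ring
    rw [e]
    refine (degree_sub_le _ _).trans_lt (max_lt ?_ (monicOP_degree_sub μ (m + 1)).1)
    rw [degree_lt_iff_coeff_zero]
    intro j hj
    obtain ⟨j, rfl⟩ : ∃ j', j = j' + 1 := ⟨j - 1, by omega⟩
    rw [coeff_X_mul]
    exact coeff_eq_zero_of_degree_lt
      ((monicOP_degree_sub μ m).1.trans_le (by exact_mod_cast (by omega : m ≤ j)))
  set R := X * monicOP μ n - monicOP μ (n + 1) - C (jacobiBeta μ n) * monicOP μ n -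
      C (jacobiGamma μ n) * monicOP μ (n - 1) with hR
  have hRd : R.degree < ((n + 1 : ℕ) : WithBot ℕ) := by
    refine (degree_sub_le _ _).trans_lt (max_lt ((degree_sub_le _ _).trans_lt
      (max_lt (dXsub n) ?_)) ?_)
    · refine (degree_C_mul_le' _ _).trans_lt ?_
      rw [(monicOP_degree_sub μ n).2]; exact_mod_cast n.lt_succ_self
    · refine (degree_C_mul_le' _ _).trans_lt ?_
      rw [(monicOP_degree_sub μ _).2]; exact_mod_cast (by omega)
  have hRk : ∀ k < n + 1, μ (R * monicOP μ k) = 0 := by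
    intro k hk
    have e : R * monicOP μ k = X * monicOP μ n * monicOP μ k - monicOP μ (n + 1) * monicOP μ k -
        jacobiBeta μ n • (monicOP μ n * monicOP μ k) -
        jacobiGamma μ n • (monicOP μ (n - 1) * monicOP μ k) := by
      rw [hR, smul_eq_C_mul, smul_eq_C_mul]; ring
    rw [e, map_sub, map_sub, map_sub, map_smul, map_smul,
      monicOP_orthogonal hμ (by omega : n + 1 ≠ k)]
    rcases Nat.lt_succ_iff_lt_or_eq.1 hk with hk | rfl
    · rw [monicOP_orthogonal hμ hk.ne']
      obtain ⟨n, rfl⟩ : ∃ n', n = n' + 1 := ⟨n - 1, by omega⟩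
      have e2 : X * monicOP μ (n + 1) * monicOP μ k = monicOP μ (n + 1) * monicOP μ (k + 1) +
          monicOP μ (n + 1) * (X * monicOP μ k - monicOP μ (k + 1)) := by ring
      rw [e2, map_add, orth (n + 1) (X * monicOP μ k - monicOP μ (k + 1))
        ((dXsub k).trans_le (by exact_mod_cast (by omega)))]
      rcases Nat.lt_succ_iff_lt_or_eq.1 hk with hk | rfl
      · rw [monicOP_orthogonal hμ (by omega : n + 1 ≠ k + 1),
          monicOP_orthogonal hμ (by omega : n + 1 - 1 ≠ k)]
        simp
      · have := hne k
        simp only [jacobiGamma, Nat.add_sub_cancel, smul_eq_mul]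
        field_simp
        ring
    · have h3 : jacobiGamma μ k • μ (monicOP μ (k - 1) * monicOP μ k) = 0 := by
        cases k with
        | zero => simp [jacobiGamma]
        | succ k => rw [monicOP_orthogonal hμ (by omega)]; simp
      have := hne k
      rw [h3, jacobiBeta, smul_eq_mul]
      field_simp
      ring
  have hR0 : R = 0 := hμ _ (monicOP_expand μ R (n + 1) hRk R hRd)
  rw [hR] at hR0
  linear_combination hR0

/-! ### The free semigroup and subtrees -/

/-- Words in the letters `{1, 2}`, which are represented by `0 1 : Fin 2`; the empty word is the
root of the binary tree and the children of `u` are the words `(i, u)`. -/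
abbrev Word : Type := List (Fin 2)

/-- The subsets `Ω` of the free semigroup that define product-type states. -/
structure IsProductTree (Ω : Set Word) : Prop where
  /-- Every postfix of a word in `Ω` is in `Ω`. -/
  hereditary : ∀ u ∈ Ω, ∀ v : Word, v <:+ u → v ∈ Ω
  /-- The constant words are in `Ω`. -/
  const_mem : ∀ (i : Fin 2) (n : ℕ), 1 ≤ n → List.replicate n i ∈ Ω
  /-- If `u ∈ Ω`, `u(1) = i`, and `(j, u) ∈ Ω` for a `j ≠ i`, then `(i, u) ∈ Ω`. -/
  same_mem : ∀ (i j : Fin 2) (u : Word), i :: u ∈ Ω → j ≠ i → j :: i :: u ∈ Ω → i :: i :: u ∈ Ω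

/-- `∂Ω = {u ∈ Ω : u(1) = i, (i, u) ∉ Ω}`. -/
def treeBoundary (Ω : Set Word) : Set Word :=
  {w | w ∈ Ω ∧ ∃ (i : Fin 2) (u : Word), w = i :: u ∧ i :: w ∉ Ω}

/-- The `k` in `w = i^k v` with `k ≥ 1` and `v(1) ≠ i` (and `0` for the empty word). -/
def leadingRun : Word → ℕ
  | [] => 0
  | i :: u => (u.takeWhile (· = i)).length + 1

/-! ### Product-type states -/

/-- The monomial `x_u` in `ℝ⟨x₁, x₂⟩`. -/
noncomputable def ncMonomial (u : Word) : FreeAlgebra ℝ (Fin 2) :=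
  (u.map (FreeAlgebra.ι ℝ)).prod

/-- The product `∏ P^{(i)}_k(x_i)` over the maximal constant blocks `i^k` of the word, in order. -/
noncomputable def blockPoly (P : Fin 2 → ℕ → ℝ[X]) : Word → FreeAlgebra ℝ (Fin 2)
  | [] => 1
  | i :: u => aeval (FreeAlgebra.ι ℝ i) (P i (leadingRun (i :: u))) *
      blockPoly P (u.dropWhile (· = i))
termination_by u => u.length
decreasing_by
  exact Nat.lt_succ_of_le (List.dropWhile_suffix _).length_le

open Classical in
/-- The polynomials `P_u`: block products for `u ∈ Ω`, and `x_v P_w` for `u = (v, w) ∉ Ω` with `w`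
the longest postfix of `u` in `Ω` (letters are moved to `v` until the rest is in `Ω`). -/
noncomputable def treePoly (P : Fin 2 → ℕ → ℝ[X]) (Ω : Set Word) : Word → FreeAlgebra ℝ (Fin 2)
  | [] => 1
  | i :: u => if i :: u ∈ Ω then blockPoly P (i :: u)
      else FreeAlgebra.ι ℝ i * treePoly P Ω u

/-- Non-commutative polynomials of degree less than `n`. -/
def ncDegreeLT (n : ℕ) : Submodule ℝ (FreeAlgebra ℝ (Fin 2)) :=
  Submodule.span ℝ (ncMonomial '' {v | v.length < n})

theorem ncMonomial_append (u v : Word) : ncMonomial (u ++ v) = ncMonomial u * ncMonomial v := by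
  simp [ncMonomial]

theorem ncDegreeLT_mono {m n : ℕ} (h : m ≤ n) : ncDegreeLT m ≤ ncDegreeLT n :=
  Submodule.span_mono (Set.image_mono fun _ hv => lt_of_lt_of_le hv h)

theorem ncMonomial_mem {v : Word} {n : ℕ} (h : v.length < n) : ncMonomial v ∈ ncDegreeLT n :=
  Submodule.subset_span ⟨v, h, rfl⟩

theorem ncDegreeLT_mul {m n : ℕ} {p q : FreeAlgebra ℝ (Fin 2)} (hp : p ∈ ncDegreeLT m)
    (hq : q ∈ ncDegreeLT n) : p * q ∈ ncDegreeLT (m + n - 1) := by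
  have h := Submodule.mul_mem_mul hp hq
  rw [ncDegreeLT, ncDegreeLT, Submodule.span_mul_span] at h
  refine Submodule.span_mono ?_ h
  rintro _ ⟨_, ⟨u, hu, rfl⟩, _, ⟨v, hv, rfl⟩, rfl⟩
  simp only [Set.mem_ofPred_eq] at hu hv
  refine ⟨u ++ v, ?_, ncMonomial_append u v⟩
  simp only [Set.mem_ofPred_eq, List.length_append]
  omega

/-- `p` is monic with leading monomial `x_u`. -/
def HasLead (u : Word) (p : FreeAlgebra ℝ (Fin 2)) : Prop := p - ncMonomial u ∈ ncDegreeLT u.length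

theorem HasLead.mul {u v : Word} {p q : FreeAlgebra ℝ (Fin 2)} (hp : HasLead u p)
    (hq : HasLead v q) : HasLead (u ++ v) (p * q) := by
  have e : p * q - ncMonomial (u ++ v) = (p - ncMonomial u) * (q - ncMonomial v) +
      (p - ncMonomial u) * ncMonomial v + ncMonomial u * (q - ncMonomial v) := by
    rw [ncMonomial_append]; noncomm_ring
  rw [HasLead, e, List.length_append]
  refine add_mem (add_mem ?_ ?_) ?_
  · exact ncDegreeLT_mono (by omega) (ncDegreeLT_mul hp hq)
  · exact ncDegreeLT_mono (by omega) (ncDegreeLT_mul hp (ncMonomial_mem (Nat.lt_succ_self _)))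
  · exact ncDegreeLT_mono (by omega) (ncDegreeLT_mul (ncMonomial_mem (Nat.lt_succ_self _)) hq)

theorem hasLead_monomial (u : Word) : HasLead u (ncMonomial u) := by simp [HasLead]

theorem hasLead_aeval (μ : ℝ[X] →ₗ[ℝ] ℝ) (i : Fin 2) (n : ℕ) :
    HasLead (List.replicate n i) (aeval (FreeAlgebra.ι ℝ i) (monicOP μ n)) := by
  have hpow : ∀ k, ncMonomial (List.replicate k i) = FreeAlgebra.ι ℝ i ^ k := by
    intro k; simp [ncMonomial]
  have e : aeval (FreeAlgebra.ι ℝ i) (monicOP μ n) - ncMonomial (List.replicate n i) =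
      aeval (FreeAlgebra.ι ℝ i) (monicOP μ n - X ^ n) := by
    rw [hpow]; simp
  rw [HasLead, e, aeval_eq_sum_range, List.length_replicate]
  refine sum_mem fun k _ => ?_
  by_cases hk : n ≤ k
  · have : (monicOP μ n - X ^ n).coeff k = 0 := coeff_eq_zero_of_degree_lt
      ((monicOP_degree_sub μ n).1.trans_le (by exact_mod_cast hk))
    rw [this, zero_smul]; exact zero_mem _
  · rw [← hpow]
    exact Submodule.smul_mem _ _ (ncMonomial_mem (by simpa using hk))

theorem takeWhile_eq_replicate (i : Fin 2) (u : Word) :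
    u.takeWhile (· = i) = List.replicate (u.takeWhile (· = i)).length i := by
  rw [List.eq_replicate_iff]
  refine ⟨rfl, fun b hb => ?_⟩
  simpa using List.mem_takeWhile_imp hb

theorem hasLead_blockPoly (μ : Fin 2 → ℝ[X] →ₗ[ℝ] ℝ) (u : Word) :
    HasLead u (blockPoly (fun i => monicOP (μ i)) u) := by
  induction h : u.length using Nat.strong_induction_on generalizing u with
  | _ n ih =>
    cases u with
    | nil => rw [blockPoly]; simpa [ncMonomial] using hasLead_monomial []
    | cons i u =>
      rw [blockPoly]
      have h2 := ih _ (by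
        rw [← h]
        exact Nat.lt_succ_of_le (List.dropWhile_suffix (· = i) (l := u)).length_le)
        (u.dropWhile (· = i)) rfl
      have h3 := (hasLead_aeval (μ i) i (leadingRun (i :: u))).mul h2
      have e : List.replicate (leadingRun (i :: u)) i ++ u.dropWhile (· = i) = i :: u := by
        rw [leadingRun, List.replicate_succ, ← takeWhile_eq_replicate, List.cons_append,
          List.takeWhile_append_dropWhile]
      rwa [e] at h3

theorem hasLead_treePoly (μ : Fin 2 → ℝ[X] →ₗ[ℝ] ℝ) (Ω : Set Word) (u : Word) :
    HasLead u (treePoly (fun i => monicOP (μ i)) Ω u) := by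
  induction u with
  | nil => simpa [treePoly, ncMonomial] using hasLead_monomial []
  | cons i u ih =>
    rw [treePoly]
    split_ifs
    · exact hasLead_blockPoly μ _
    · simpa [ncMonomial] using (hasLead_monomial [i]).mul ih

/-- The monomials as a basis of `ℝ⟨x₁, x₂⟩`. -/
noncomputable def ncMonomialBasis : Module.Basis Word ℝ (FreeAlgebra ℝ (Fin 2)) :=
  (FreeAlgebra.basisFreeMonoid ℝ (Fin 2)).reindex FreeMonoid.toList

theorem ncMonomialBasis_apply (u : Word) : ncMonomialBasis u = ncMonomial u := by
  have h : (FreeAlgebra.basisFreeMonoid ℝ (Fin 2)) (FreeMonoid.ofList u) =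
      FreeMonoid.lift (FreeAlgebra.ι ℝ) (FreeMonoid.ofList u) := by
    simp [FreeAlgebra.basisFreeMonoid, FreeAlgebra.equivMonoidAlgebraFreeMonoid]
  rw [ncMonomialBasis, Module.Basis.reindex_apply]
  exact h.trans (by simp [FreeMonoid.lift_apply, ncMonomial])

/-- The linear map `x_u ↦ P_u`. -/
noncomputable def treeMap (μ : Fin 2 → ℝ[X] →ₗ[ℝ] ℝ) (Ω : Set Word) :
    FreeAlgebra ℝ (Fin 2) →ₗ[ℝ] FreeAlgebra ℝ (Fin 2) :=
  ncMonomialBasis.constr ℝ (treePoly (fun i => monicOP (μ i)) Ω)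

theorem treeMap_monomial (μ : Fin 2 → ℝ[X] →ₗ[ℝ] ℝ) (Ω : Set Word) (u : Word) :
    treeMap μ Ω (ncMonomial u) = treePoly (fun i => monicOP (μ i)) Ω u := by
  rw [treeMap, ← ncMonomialBasis_apply, Module.Basis.constr_basis]

theorem ncDegreeLT_le_map_treeMap (μ : Fin 2 → ℝ[X] →ₗ[ℝ] ℝ) (Ω : Set Word) (n : ℕ) :
    ncDegreeLT n ≤ (ncDegreeLT n).map (treeMap μ Ω) := by
  induction n with
  | zero => simp [ncDegreeLT]
  | succ n ih =>
    rw [ncDegreeLT, Submodule.span_le]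
    rintro _ ⟨u, hu, rfl⟩
    have hu' : u.length ≤ n := Nat.lt_succ_iff.1 hu
    have h1 := ncDegreeLT_mono hu' (hasLead_treePoly μ Ω u)
    have h2 := Submodule.map_mono (ncDegreeLT_mono n.le_succ) (ih h1)
    have h3 : treePoly (fun i => monicOP (μ i)) Ω u ∈ (ncDegreeLT (n + 1)).map (treeMap μ Ω) :=
      ⟨_, ncMonomial_mem hu, treeMap_monomial μ Ω u⟩
    have := sub_mem h3 h2
    rwa [sub_sub_cancel] at this

theorem exists_mem_ncDegreeLT (p : FreeAlgebra ℝ (Fin 2)) : ∃ n, p ∈ ncDegreeLT n := by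
  have hp : p ∈ Submodule.span ℝ (Set.range ncMonomialBasis) := by
    rw [ncMonomialBasis.span_eq]; trivial
  induction hp using Submodule.span_induction with
  | mem x hx =>
    obtain ⟨u, rfl⟩ := hx
    exact ⟨u.length + 1, by rw [ncMonomialBasis_apply]; exact ncMonomial_mem (Nat.lt_succ_self _)⟩
  | zero => exact ⟨0, zero_mem _⟩
  | add x y _ _ hx hy =>
    obtain ⟨m, hm⟩ := hx
    obtain ⟨n, hn⟩ := hy
    exact ⟨max m n, add_mem (ncDegreeLT_mono (le_max_left _ _) hm)
      (ncDegreeLT_mono (le_max_right _ _) hn)⟩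
  | smul a x _ hx =>
    obtain ⟨n, hn⟩ := hx
    exact ⟨n, Submodule.smul_mem _ _ hn⟩

theorem treeMap_bijective (μ : Fin 2 → ℝ[X] →ₗ[ℝ] ℝ) (Ω : Set Word) :
    Function.Bijective (treeMap μ Ω) := by
  constructor
  · rw [injective_iff_map_eq_zero]
    intro p hp
    obtain ⟨n, hn⟩ := exists_mem_ncDegreeLT p
    have hfin : (ncMonomial '' {v | v.length < n}).Finite := (List.finite_length_lt _ n).image _
    have : FiniteDimensional ℝ (ncDegreeLT n) := FiniteDimensional.span_of_finite ℝ hfin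
    have hmaps : ∀ q ∈ ncDegreeLT n, treeMap μ Ω q ∈ ncDegreeLT n := by
      have : (ncDegreeLT n).map (treeMap μ Ω) ≤ ncDegreeLT n := by
        rw [ncDegreeLT, Submodule.map_span, Submodule.span_le]
        rintro _ ⟨_, ⟨u, hu, rfl⟩, rfl⟩
        rw [treeMap_monomial]
        have h := add_mem (ncDegreeLT_mono (le_of_lt hu) (hasLead_treePoly μ Ω u))
          (ncMonomial_mem (n := n) hu)
        rwa [sub_add_cancel] at h
      exact fun q hq => this ⟨q, hq, rfl⟩
    have hsurj : Function.Surjective ((treeMap μ Ω).restrict hmaps) := by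
      rintro ⟨q, hq⟩
      obtain ⟨r, hr, hrq⟩ := ncDegreeLT_le_map_treeMap μ Ω n hq
      exact ⟨⟨r, hr⟩, Subtype.ext hrq⟩
    have hinj := LinearMap.injective_iff_surjective.2 hsurj
    have h0 : (⟨p, hn⟩ : ncDegreeLT n) = 0 := hinj (Subtype.ext (by simpa using hp))
    exact congrArg Subtype.val h0
  · intro p
    obtain ⟨n, hn⟩ := exists_mem_ncDegreeLT p
    obtain ⟨q, _, hq⟩ := ncDegreeLT_le_map_treeMap μ Ω n hn
    exact ⟨q, hq⟩

/-- The polynomials `P_u` as a basis of `ℝ⟨x₁, x₂⟩`. -/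
noncomputable def treeBasis (μ : Fin 2 → ℝ[X] →ₗ[ℝ] ℝ) (Ω : Set Word) :
    Module.Basis Word ℝ (FreeAlgebra ℝ (Fin 2)) :=
  ncMonomialBasis.map (LinearEquiv.ofBijective (treeMap μ Ω) (treeMap_bijective μ Ω))

theorem treeBasis_apply (μ : Fin 2 → ℝ[X] →ₗ[ℝ] ℝ) (Ω : Set Word) (u : Word) :
    treeBasis μ Ω u = treePoly (fun i => monicOP (μ i)) Ω u := by
  simp [treeBasis, ncMonomialBasis_apply, treeMap_monomial]

/-- The functional `φ_Ω`, that is, the linear functional on `ℝ⟨x₁, x₂⟩` with `φ_Ω[1] = 1` and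
`φ_Ω[P_u] = 0` for all words `u` of length at least one. Here `1 = P_u` for the empty word `u`. -/
noncomputable def productTypeState (μ : Fin 2 → ℝ[X] →ₗ[ℝ] ℝ) (Ω : Set Word) :
    FreeAlgebra ℝ (Fin 2) →ₗ[ℝ] ℝ :=
  (treeBasis μ Ω).constr ℝ (fun u => if u.length = 0 then 1 else 0)

theorem productTypeState_iff (μ : Fin 2 → ℝ[X] →ₗ[ℝ] ℝ) (Ω : Set Word)
    (φ : FreeAlgebra ℝ (Fin 2) →ₗ[ℝ] ℝ) :
    φ = productTypeState μ Ω ↔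
      φ 1 = 1 ∧ ∀ u : Word, 1 ≤ u.length → φ (treePoly (fun i => monicOP (μ i)) Ω u) = 0 := by
  have hval : ∀ u : Word, productTypeState μ Ω (treePoly (fun i => monicOP (μ i)) Ω u) =
      if u.length = 0 then 1 else 0 := by
    intro u
    rw [productTypeState, ← treeBasis_apply, Module.Basis.constr_basis]
  constructor
  · rintro rfl
    refine ⟨by simpa [treePoly] using hval [], fun u hu => ?_⟩
    rw [hval, if_neg (by omega)]
  · rintro ⟨h1, h2⟩
    refine (treeBasis μ Ω).ext fun u => ?_
    rw [treeBasis_apply, hval]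
    split_ifs with h
    · rw [List.length_eq_zero_iff] at h
      subst h
      simpa [treePoly] using h1
    · exact h2 u (by omega)

/-! ### Moment generating functions and branched continued fractions -/

/-- The moment generating function `∑_w φ[x_w] z_w`. -/
noncomputable def momentSeries (φ : FreeAlgebra ℝ (Fin 2) →ₗ[ℝ] ℝ) : NCPowerSeries (Fin 2) ℝ :=
  fun w => φ (ncMonomial w)

open Classical in
/-- The entry of the fraction at the word `(i, u)`, written as `i^k v` with `v(1) ≠ i`: it is
`β^{(i)}_{k-1} z_i + γ^{(i)}_k z_i F z_i` if the word is in `Ω \ ∂Ω`, where `F` is the fraction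
`1 / (1 - …)` to be inserted at the bar, it is `β^{(i)}_{k-1} z_i` if the word is in `∂Ω`, and there
is no entry if the word is not in `Ω`. -/
noncomputable def cfEntry (β γ : Fin 2 → ℕ → ℝ) (Ω : Set Word) (i : Fin 2) (u : Word)
    (F : NCPowerSeries (Fin 2) ℝ) : NCPowerSeries (Fin 2) ℝ :=
  if i :: u ∈ Ω \ treeBoundary Ω then
    β i (leadingRun (i :: u) - 1) • NCPowerSeries.var i +
      γ i (leadingRun (i :: u)) • (NCPowerSeries.var i * F * NCPowerSeries.var i)
  else if i :: u ∈ treeBoundary Ω then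
    β i (leadingRun (i :: u) - 1) • NCPowerSeries.var i
  else 0

/-- The fraction `1 / (1 - …)` at the vertex `u`, with the entries at its children `(i, u)` in the
denominator, truncated after `n` levels (the fractions below are replaced by `0`). -/
noncomputable def cfConvergent (β γ : Fin 2 → ℕ → ℝ) (Ω : Set Word) :
    ℕ → Word → NCPowerSeries (Fin 2) ℝ
  | 0, _ => 0
  | n + 1, u => Ring.inverse (1 - ∑ i, cfEntry β γ Ω i u (cfConvergent β γ Ω n (i :: u)))

/-- The series `M` is the value of the infinite scalar branched continued fraction whose branching
follows `Ω`: every denominator in every truncation is invertible, and each coefficient of the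
truncations of the whole fraction is eventually equal to that of `M`. -/
def HasBranchedCF (β γ : Fin 2 → ℕ → ℝ) (Ω : Set Word) (M : NCPowerSeries (Fin 2) ℝ) : Prop :=
  (∀ (n : ℕ) (u : Word),
    IsUnit (1 - ∑ i, cfEntry β γ Ω i u (cfConvergent β γ Ω n (i :: u)))) ∧
  ∀ w : Word, ∀ᶠ n in Filter.atTop,
    NCPowerSeries.coeff w (cfConvergent β γ Ω n []) = NCPowerSeries.coeff w M

/-! Put `V_u = ∑_w φ_Ω[x_w P_u] z_w`, so that `V_∅ = M`. In `x_w x_j P_u` the last letter `j` meets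
`P_u` first. If `(j,u) ∉ Ω`, then `x_j P_u = P_{(j,u)}`, and multiplying further from the left only
produces other `P`'s, on which `φ_Ω` vanishes. If `(j,u) ∈ Ω`, the three-term recursion in the
leading `j`-block splits `x_j P_u` into a raised, a level and a lowered term. Hence
(`vertexSeries_eq`) `V_u = L_u + ∑_{(j,u) ∈ Ω} (V_{(j,u)} + β V_u) z_j`, where `L_∅ = 1`, and
`L_{(i,u)}` is `γ V_u z_i` if `(i,i,u) ∈ Ω` and `0` otherwise.

The ansatz `V_u = L_u F_u` solves this system: since `L_{(j,u)}` contains `V_u` as its left factor,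
inserting the ansatz at the children gives `V_u (1 - ∑ E_{(j,u)}) = L_u`, which is the fraction at
`u`. For truncations, the defect `V_u - L_u F_u^{(n+1)}` is the sum of the defects `V_{(j,u)} -
L_{(j,u)} F_{(j,u)}^{(n)}`, each times `z_j`, multiplied on the right by the inverse denominator.
Each level therefore gains one degree (`vertexSeries_sub_mem_orderGE`), and at the root `L_∅ = 1`.
The denominators are invertible because their constant coefficient is `1`
(`NCPowerSeries.isUnit_of_nil_eq_one`). -/

/-! ### Inverses and order of series in non-commuting variables -/

namespace NCPowerSeries

/-- Splitting off the last letter suits an action from the left: the last letter of `w` is the first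
to act on `P_u`, and it appears as a right factor `z_j`. -/
theorem ext_concat {σ R : Type*} {f g : NCPowerSeries σ R} (h0 : f [] = g [])
    (h : ∀ w j, f (w ++ [j]) = g (w ++ [j])) : f = g := by
  funext w
  induction w using List.reverseRecOn with
  | nil => exact h0
  | append_singleton w j _ => exact h w j

section Ring

variable {σ R : Type*} [Ring R]

theorem one_nil : (1 : NCPowerSeries σ R) [] = 1 := rfl

theorem one_concat (w : List σ) (j : σ) : (1 : NCPowerSeries σ R) (w ++ [j]) = 0 :=
  if_neg (by simp)

theorem sub_apply (f g : NCPowerSeries σ R) (w : List σ) : (f - g) w = f w - g w := rfl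

theorem smul_apply (c : R) (f : NCPowerSeries σ R) (w : List σ) : (c • f) w = c * f w := rfl

theorem var_nil (i : σ) : (var i : NCPowerSeries σ R) [] = 0 := if_neg (by simp)

theorem mul_var_nil (f : NCPowerSeries σ R) (i : σ) : (f * var i : NCPowerSeries σ R) [] = 0 := by
  rw [mul_nil, var_nil, mul_zero]

open Classical in
theorem mul_var_concat (f : NCPowerSeries σ R) (i j : σ) (w : List σ) :
    (f * var i : NCPowerSeries σ R) (w ++ [j]) = if j = i then f w else 0 := by
  change ∑ k ∈ Finset.range _, f _ * (if _ = [i] then 1 else 0) = _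
  rw [Finset.sum_eq_single w.length]
  · simp
  · intro k _ hk
    rw [if_neg, mul_zero]
    intro h
    have := congrArg List.length h
    simp only [List.length_drop, List.length_append, List.length_singleton] at this
    omega
  · simp

theorem smul_mul (c : R) (f g : NCPowerSeries σ R) : (c • f) * g = c • (f * g) :=
  funext (NCPowerSeries.smul_mul' c f g)

/-- A series with constant coefficient `1` has a right inverse. -/
theorem exists_mul_eq_one {f : NCPowerSeries σ R} (hf : f [] = 1) :
    ∃ g : NCPowerSeries σ R, f * g = 1 := by
  have H : ∀ n : ℕ, ∃ g : NCPowerSeries σ R,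
      ∀ w : List σ, w.length < n → (f * g) w = (1 : NCPowerSeries σ R) w := by
    intro n
    induction n with
    | zero => exact ⟨0, fun w hw => absurd hw (Nat.not_lt_zero _)⟩
    | succ n ih =>
      obtain ⟨g, hg⟩ := ih
      -- Correcting by the residual `f g - 1` replaces it by `-(f - 1)(f g - 1)`; as `f - 1` has no
      -- constant term, one degree is gained.
      refine ⟨g - (f * g - 1), fun w hw => ?_⟩
      have key : ((f - 1) * (f * g - 1)) w = 0 := by
        refine Finset.sum_eq_zero fun k _ => ?_
        rcases Nat.eq_zero_or_pos k with rfl | hk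
        · rw [List.take_zero, sub_apply, hf, one_nil, sub_self, zero_mul]
        · rcases Nat.eq_zero_or_pos w.length with h0 | h0
          · rw [List.length_eq_zero_iff.1 h0, List.take_nil, sub_apply, hf, one_nil, sub_self,
              zero_mul]
          · rw [sub_apply (f * g), hg _ (by rw [List.length_drop]; omega), sub_self, mul_zero]
      have e : f * (g - (f * g - 1)) = 1 - (f - 1) * (f * g - 1) := by noncomm_ring
      rw [e, sub_apply, key, sub_zero]
  choose G hG using H
  -- As `f` has constant coefficient `1`, the coefficient of `g` at `w` is determined by that of `f
  -- g` and by `g` on shorter words. The approximate inverses thus agree where both are valid and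
  -- glue along the diagonal.
  have stable : ∀ n m, ∀ w : List σ, w.length < n → w.length < m → G n w = G m w := by
    intro n m w
    induction h : w.length using Nat.strong_induction_on generalizing w with
    | _ l ih =>
      intro hn hm
      have h1 : (f * G n) w = (f * G m) w :=
        (hG n w (h ▸ hn)).trans (hG m w (h ▸ hm)).symm
      change ∑ k ∈ Finset.range _, _ = ∑ k ∈ Finset.range _, _ at h1
      rw [Finset.sum_range_succ', Finset.sum_range_succ'] at h1
      have h2 : ∀ k ∈ Finset.range w.length, f (w.take (k + 1)) * G n (w.drop (k + 1)) =
          f (w.take (k + 1)) * G m (w.drop (k + 1)) := by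
        intro k hk
        rw [Finset.mem_range] at hk
        rw [ih (w.drop (k + 1)).length (by rw [List.length_drop]; omega) _ rfl
          (by rw [List.length_drop]; omega) (by rw [List.length_drop]; omega)]
      rw [Finset.sum_congr rfl h2] at h1
      simpa [hf] using h1
  refine ⟨fun w => G (w.length + 1) w, funext fun w => ?_⟩
  rw [← hG (w.length + 1) w (Nat.lt_succ_self _)]
  refine Finset.sum_congr rfl fun k _ => ?_
  congr 1
  exact stable _ _ _ (Nat.lt_succ_self _) (by rw [List.length_drop]; omega)

/-- The right inverse again has constant coefficient `1`, so it has a right inverse too, which must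
be `f`. -/
theorem isUnit_of_nil_eq_one {f : NCPowerSeries σ R} (hf : f [] = 1) : IsUnit f := by
  obtain ⟨g, hg⟩ := exists_mul_eq_one hf
  have hg0 : g [] = 1 := by
    have h := congrFun hg []
    rwa [mul_nil, hf, one_mul] at h
  obtain ⟨h, hh⟩ := exists_mul_eq_one hg0
  have hfh : f = h := by rw [← mul_one f, ← hh, ← mul_assoc, hg, one_mul]
  exact ⟨⟨f, g, hg, by rw [hfh, hh]⟩, rfl⟩

/-- The series without terms of degree less than `n`. -/
def orderGE (n : ℕ) : AddSubgroup (NCPowerSeries σ R) where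
  carrier := {f | ∀ w : List σ, w.length < n → f w = 0}
  zero_mem' := fun _ _ => rfl
  add_mem' := fun hf hg w hw => by rw [add_apply, hf w hw, hg w hw, add_zero]
  neg_mem' := fun {f} hf w hw => by
    change -f w = 0
    rw [hf w hw, neg_zero]

theorem mul_mem_orderGE {n : ℕ} {f : NCPowerSeries σ R} (hf : f ∈ orderGE n)
    (g : NCPowerSeries σ R) : f * g ∈ orderGE n := by
  intro w hw
  refine Finset.sum_eq_zero fun k _ => ?_
  rw [hf (w.take k) ((List.length_take_le' k w).trans_lt hw), zero_mul]

/-- This gain of one degree makes the truncations converge. -/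
theorem mul_var_mem_orderGE {n : ℕ} {f : NCPowerSeries σ R} (hf : f ∈ orderGE n) (i : σ) :
    f * var i ∈ orderGE (n + 1) := by
  classical
  intro w hw
  induction w using List.reverseRecOn with
  | nil => exact mul_var_nil f i
  | append_singleton w j _ =>
    rw [mul_var_concat, hf w (by simpa using hw), ite_self]

end Ring

theorem mul_smul' {σ R : Type*} [CommRing R] (c : R) (f g : NCPowerSeries σ R) :
    f * (c • g) = c • (f * g) := by
  funext w
  change ∑ k ∈ Finset.range _, _ * (c * _) = _ * ∑ k ∈ Finset.range _, _
  rw [Finset.mul_sum]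
  exact Finset.sum_congr rfl fun k _ => by ring

end NCPowerSeries

/-! ### Multiplication by a letter -/

/-- Allowing `k = 0` treats a letter that opens a new block like one that extends the leading block.
-/
theorem exists_eq_replicate_append (j : Fin 2) (u : Word) :
    ∃ (k : ℕ) (v : Word), u = List.replicate k j ++ v ∧ v.head? ≠ some j := by
  induction u with
  | nil => exact ⟨0, [], rfl, by simp⟩
  | cons a u ih =>
    by_cases h : a = j
    · subst h
      obtain ⟨k, v, rfl, hv⟩ := ih
      exact ⟨k + 1, v, rfl, hv⟩
    · exact ⟨0, a :: u, rfl, by simpa using h⟩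

theorem takeWhile_replicate_append (j : Fin 2) (k : ℕ) {v : Word} (hv : v.head? ≠ some j) :
    (List.replicate k j ++ v).takeWhile (· = j) = List.replicate k j := by
  induction k with
  | zero =>
    cases v with
    | nil => rfl
    | cons a v => simpa using hv
  | succ k ih => simpa [List.replicate_succ] using ih

theorem dropWhile_replicate_append (j : Fin 2) (k : ℕ) {v : Word} (hv : v.head? ≠ some j) :
    (List.replicate k j ++ v).dropWhile (· = j) = v := by
  induction k with
  | zero =>
    cases v with
    | nil => rfl
    | cons a v =>
      have ha : a ≠ j := by simpa using hv
      simp [ha]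
  | succ k ih => simpa [List.replicate_succ] using ih

theorem leadingRun_replicate_append (j : Fin 2) (k : ℕ) {v : Word} (hv : v.head? ≠ some j) :
    leadingRun (j :: (List.replicate k j ++ v)) = k + 1 := by
  rw [leadingRun, takeWhile_replicate_append j k hv, List.length_replicate]

theorem blockPoly_replicate_append (μ : Fin 2 → ℝ[X] →ₗ[ℝ] ℝ) (j : Fin 2) (k : ℕ) {v : Word}
    (hv : v.head? ≠ some j) :
    blockPoly (fun i => monicOP (μ i)) (List.replicate k j ++ v) =
      aeval (FreeAlgebra.ι ℝ j) (monicOP (μ j) k) * blockPoly (fun i => monicOP (μ i)) v := by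
  cases k with
  | zero => simp [monicOP_zero]
  | succ k =>
    rw [List.replicate_succ, List.cons_append, blockPoly, leadingRun_replicate_append j k hv,
      dropWhile_replicate_append j k hv]

/-- Multiplication of `P_u` for `u = j^k v`, `v(1) ≠ j`, by the letter `x_j`. -/
theorem ι_mul_blockPoly {μ : Fin 2 → ℝ[X] →ₗ[ℝ] ℝ} (hμ : ∀ i, IsFaithfulPoly (μ i))
    (j : Fin 2) (k : ℕ) {v : Word} (hv : v.head? ≠ some j) :
    FreeAlgebra.ι ℝ j * blockPoly (fun i => monicOP (μ i)) (List.replicate k j ++ v) =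
      blockPoly (fun i => monicOP (μ i)) (j :: (List.replicate k j ++ v)) +
      jacobiBeta (μ j) k • blockPoly (fun i => monicOP (μ i)) (List.replicate k j ++ v) +
      jacobiGamma (μ j) k •
        blockPoly (fun i => monicOP (μ i)) (List.replicate (k - 1) j ++ v) := by
  have e : j :: (List.replicate k j ++ v) = List.replicate (k + 1) j ++ v := rfl
  -- Only the first block is affected, through the one-variable recursion evaluated at `x_j`. For `k
  -- = 0` the truncated index `k - 1 = 0` is harmless because `γ_0 = 0`.
  have h := congrArg (aeval (FreeAlgebra.ι ℝ j)) (monicOP_recursion (hμ j) k)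
  simp only [← smul_eq_C_mul, map_add, map_mul, map_smul, aeval_X] at h
  rw [e, blockPoly_replicate_append μ j k hv, blockPoly_replicate_append μ j (k + 1) hv,
    blockPoly_replicate_append μ j (k - 1) hv, ← mul_assoc, h, add_mul, add_mul,
    smul_mul_assoc, smul_mul_assoc]

theorem treePoly_of_mem (P : Fin 2 → ℕ → ℝ[X]) {Ω : Set Word} {u : Word} (hu : u ∈ Ω) :
    treePoly P Ω u = blockPoly P u := by
  cases u with
  | nil => rw [treePoly, blockPoly]
  | cons i u => rw [treePoly, if_pos hu]

theorem treePoly_cons_of_notMem (P : Fin 2 → ℕ → ℝ[X]) {Ω : Set Word} {i : Fin 2} {u : Word}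
    (hu : i :: u ∉ Ω) : treePoly P Ω (i :: u) = FreeAlgebra.ι ℝ i * treePoly P Ω u := by
  rw [treePoly, if_neg hu]

/-- Closure of `Ω` under postfixes keeps every extension of `u` outside `Ω`, so each new letter is
simply a factor. -/
theorem ncMonomial_mul_treePoly (P : Fin 2 → ℕ → ℝ[X]) {Ω : Set Word} (hΩ : IsProductTree Ω)
    {u : Word} (hu : u ∉ Ω) (w : Word) :
    ncMonomial w * treePoly P Ω u = treePoly P Ω (w ++ u) := by
  induction w with
  | nil => simp [ncMonomial]
  | cons i w ih =>
    rw [List.cons_append, treePoly_cons_of_notMem, ← ih, ← mul_assoc]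
    · simp [ncMonomial]
    · exact fun h => hu (hΩ.hereditary _ h _ ⟨i :: w, rfl⟩)

/-! ### The moment series relative to a vertex -/

/-- The series `∑_w φ_Ω[x_w P_u] z_w`. -/
noncomputable def vertexSeries (μ : Fin 2 → ℝ[X] →ₗ[ℝ] ℝ) (Ω : Set Word) (u : Word) :
    NCPowerSeries (Fin 2) ℝ :=
  fun w => productTypeState μ Ω (ncMonomial w * treePoly (fun i => monicOP (μ i)) Ω u)

open Classical in
/-- The part of `∑_w φ_Ω[x_w P_u] z_w` that comes from lowering `u` by its first letter, and
from the constant term. -/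
noncomputable def loweringSeries (μ : Fin 2 → ℝ[X] →ₗ[ℝ] ℝ) (Ω : Set Word) :
    Word → NCPowerSeries (Fin 2) ℝ
  | [] => 1
  | i :: u => if i :: i :: u ∈ Ω then
      jacobiGamma (μ i) (leadingRun (i :: u)) • (vertexSeries μ Ω u * NCPowerSeries.var i) else 0

theorem productTypeState_treePoly (μ : Fin 2 → ℝ[X] →ₗ[ℝ] ℝ) (Ω : Set Word) (u : Word) :
    productTypeState μ Ω (treePoly (fun i => monicOP (μ i)) Ω u) =
      if u.length = 0 then 1 else 0 := by
  rw [productTypeState, ← treeBasis_apply, Module.Basis.constr_basis]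

theorem vertexSeries_nil_word (μ : Fin 2 → ℝ[X] →ₗ[ℝ] ℝ) (Ω : Set Word) :
    vertexSeries μ Ω [] = momentSeries (productTypeState μ Ω) := by
  funext w
  simp [vertexSeries, momentSeries, treePoly]

theorem vertexSeries_apply_nil (μ : Fin 2 → ℝ[X] →ₗ[ℝ] ℝ) (Ω : Set Word) (u : Word) :
    vertexSeries μ Ω u [] = if u.length = 0 then 1 else 0 := by
  rw [← productTypeState_treePoly μ Ω u]
  simp [vertexSeries, ncMonomial]

/-- The product is a single `P` with non-empty index; this is why the fraction has no branch at a
child outside `Ω`. -/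
theorem vertexSeries_concat_of_notMem {μ : Fin 2 → ℝ[X] →ₗ[ℝ] ℝ} {Ω : Set Word}
    (hΩ : IsProductTree Ω) {j : Fin 2} {u : Word} (hj : j :: u ∉ Ω) (w : Word) :
    vertexSeries μ Ω u (w ++ [j]) = 0 := by
  have h : ncMonomial (w ++ [j]) * treePoly (fun i => monicOP (μ i)) Ω u =
      treePoly (fun i => monicOP (μ i)) Ω (w ++ j :: u) := by
    rw [← ncMonomial_mul_treePoly _ hΩ hj, treePoly_cons_of_notMem _ hj, ncMonomial_append,
      mul_assoc]
    simp [ncMonomial]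
  rw [vertexSeries, h, productTypeState_treePoly, if_neg (by simp)]

theorem vertexSeries_concat_of_mem {μ : Fin 2 → ℝ[X] →ₗ[ℝ] ℝ} {Ω : Set Word}
    (hμ : ∀ i, IsFaithfulPoly (μ i)) (hΩ : IsProductTree Ω) {j : Fin 2} {k : ℕ} {v : Word}
    (hv : v.head? ≠ some j) (hj : j :: (List.replicate k j ++ v) ∈ Ω) (w : Word) :
    vertexSeries μ Ω (List.replicate k j ++ v) (w ++ [j]) =
      vertexSeries μ Ω (j :: (List.replicate k j ++ v)) w +
      jacobiBeta (μ j) k * vertexSeries μ Ω (List.replicate k j ++ v) w +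
      jacobiGamma (μ j) k * vertexSeries μ Ω (List.replicate (k - 1) j ++ v) w := by
  have h1 : List.replicate k j ++ v ∈ Ω := hΩ.hereditary _ hj _ (List.suffix_cons _ _)
  have h2 : List.replicate (k - 1) j ++ v ∈ Ω := by
    -- The removed prefix has `k - (k - 1)` letters: one, or none when `k = 0`.
    refine hΩ.hereditary _ h1 _ ⟨List.replicate (k - (k - 1)) j, ?_⟩
    rw [← List.append_assoc, List.replicate_append_replicate]
    congr 3
    omega
  have e : ncMonomial (w ++ [j]) = ncMonomial w * FreeAlgebra.ι ℝ j := by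
    rw [ncMonomial_append]; simp [ncMonomial]
  simp only [vertexSeries, e]
  rw [treePoly_of_mem _ h1, treePoly_of_mem _ h2, treePoly_of_mem _ hj, mul_assoc,
    ι_mul_blockPoly hμ j k hv]
  simp only [mul_add, mul_smul_comm, map_add, map_smul, smul_eq_mul]

theorem loweringSeries_nil (μ : Fin 2 → ℝ[X] →ₗ[ℝ] ℝ) (Ω : Set Word) (u : Word) :
    loweringSeries μ Ω u [] = if u.length = 0 then 1 else 0 := by
  cases u with
  | nil => rfl
  | cons i u =>
    rw [loweringSeries]
    split_ifs
    · simp at *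
    · rw [NCPowerSeries.smul_apply, NCPowerSeries.mul_var_nil, mul_zero]
    · simp at *
    · rfl

open Classical in
theorem loweringSeries_concat (μ : Fin 2 → ℝ[X] →ₗ[ℝ] ℝ) (Ω : Set Word) (j : Fin 2) (k : ℕ)
    {v : Word} (hv : v.head? ≠ some j) (w : Word) :
    loweringSeries μ Ω (List.replicate k j ++ v) (w ++ [j]) =
      if j :: (List.replicate k j ++ v) ∈ Ω then
        jacobiGamma (μ j) k * vertexSeries μ Ω (List.replicate (k - 1) j ++ v) w else 0 := by
  cases k with
  | zero =>
    -- For `k = 0` the right side vanishes by `γ_0 = 0`. On the left, the series is `1`, is `0`, or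
    -- ends in the first letter of `v`, which is not `j`.
    simp only [jacobiGamma, zero_mul, ite_self, List.replicate_zero, List.nil_append]
    cases v with
    | nil => exact NCPowerSeries.one_concat w j
    | cons i v =>
      have hij : j ≠ i := by simpa [eq_comm] using hv
      rw [loweringSeries]
      split_ifs
      · rw [NCPowerSeries.smul_apply, NCPowerSeries.mul_var_concat, if_neg hij, mul_zero]
      · rfl
  | succ k =>
    rw [List.replicate_succ, List.cons_append, loweringSeries,
      leadingRun_replicate_append j k hv]
    split_ifs
    · rw [NCPowerSeries.smul_apply, NCPowerSeries.mul_var_concat, if_pos rfl, Nat.add_sub_cancel]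
    · rfl

open Classical in
/-- The linear equations for the vertex series given by multiplication by the letters. -/
theorem vertexSeries_eq {μ : Fin 2 → ℝ[X] →ₗ[ℝ] ℝ} (hμ : ∀ i, IsFaithfulPoly (μ i))
    {Ω : Set Word} (hΩ : IsProductTree Ω) (u : Word) :
    vertexSeries μ Ω u = loweringSeries μ Ω u + ∑ j : Fin 2, if j :: u ∈ Ω then
      (vertexSeries μ Ω (j :: u) + jacobiBeta (μ j) (leadingRun (j :: u) - 1) •
        vertexSeries μ Ω u) * NCPowerSeries.var j else 0 := by
  have sum_apply : ∀ (F : Fin 2 → NCPowerSeries (Fin 2) ℝ) (w : Word),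
      (∑ j, F j) w = ∑ j, F j w := by
    intro F w
    rw [Fin.sum_univ_two, Fin.sum_univ_two, NCPowerSeries.add_apply]
  refine NCPowerSeries.ext_concat ?_ fun w j => ?_
  · rw [NCPowerSeries.add_apply, sum_apply, Finset.sum_eq_zero, add_zero, loweringSeries_nil,
      vertexSeries_apply_nil]
    intro j _
    split_ifs
    · rw [NCPowerSeries.mul_var_nil]
    · rfl
  · rw [NCPowerSeries.add_apply, sum_apply, Finset.sum_eq_single j]
    · obtain ⟨k, v, rfl, hv⟩ := exists_eq_replicate_append j u
      rw [loweringSeries_concat μ Ω j k hv]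
      split_ifs with hj
      · rw [vertexSeries_concat_of_mem hμ hΩ hv hj, NCPowerSeries.mul_var_concat, if_pos rfl,
          NCPowerSeries.add_apply, NCPowerSeries.smul_apply, leadingRun_replicate_append j k hv,
          Nat.add_sub_cancel]
        ring
      · rw [vertexSeries_concat_of_notMem hΩ hj]
        exact (add_zero _).symm
    · intro i _ hi
      split_ifs
      · rw [NCPowerSeries.mul_var_concat, if_neg hi.symm]
      · rfl
    · simp

/-! ### The truncations of the fraction -/

theorem cons_mem_treeBoundary {Ω : Set Word} {i : Fin 2} {u : Word} :
    i :: u ∈ treeBoundary Ω ↔ i :: u ∈ Ω ∧ i :: i :: u ∉ Ω := by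
  constructor
  · rintro ⟨h, i', u', e, h'⟩
    obtain ⟨rfl, rfl⟩ := List.cons.inj e
    exact ⟨h, h'⟩
  · rintro ⟨h, h'⟩
    exact ⟨h, i, u, rfl, h'⟩

open Classical in
-- In this form the `γ`-term depends on the same condition `(i,i,u) ∈ Ω` as `loweringSeries` at
-- `(i,u)`.
theorem cfEntry_eq (β γ : Fin 2 → ℕ → ℝ) (Ω : Set Word) (i : Fin 2) (u : Word)
    (F : NCPowerSeries (Fin 2) ℝ) :
    cfEntry β γ Ω i u F = if i :: u ∈ Ω then
      β i (leadingRun (i :: u) - 1) • NCPowerSeries.var i +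
        (if i :: i :: u ∈ Ω then γ i (leadingRun (i :: u)) •
          (NCPowerSeries.var i * F * NCPowerSeries.var i) else 0) else 0 := by
  simp only [cfEntry, Set.mem_sdiff, cons_mem_treeBoundary]
  by_cases h : i :: u ∈ Ω <;> by_cases h' : i :: i :: u ∈ Ω <;> simp [h, h']

theorem cfEntry_nil (β γ : Fin 2 → ℕ → ℝ) (Ω : Set Word) (i : Fin 2) (u : Word)
    (F : NCPowerSeries (Fin 2) ℝ) : cfEntry β γ Ω i u F [] = 0 := by
  rw [cfEntry]
  split_ifs
  · rw [NCPowerSeries.add_apply, NCPowerSeries.smul_apply, NCPowerSeries.smul_apply,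
      NCPowerSeries.mul_var_nil, NCPowerSeries.var_nil, mul_zero, mul_zero, add_zero]
  · rw [NCPowerSeries.smul_apply, NCPowerSeries.var_nil, mul_zero]
  · rfl

theorem isUnit_one_sub_sum_cfEntry (β γ : Fin 2 → ℕ → ℝ) (Ω : Set Word) (u : Word)
    (F : Fin 2 → NCPowerSeries (Fin 2) ℝ) : IsUnit (1 - ∑ i, cfEntry β γ Ω i u (F i)) := by
  apply NCPowerSeries.isUnit_of_nil_eq_one
  rw [Fin.sum_univ_two, NCPowerSeries.sub_apply, NCPowerSeries.add_apply, cfEntry_nil,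
    cfEntry_nil, NCPowerSeries.one_nil, add_zero, sub_zero]

/-- The vertex series is approximated by the lowering series times the truncated fraction. -/
theorem vertexSeries_sub_mem_orderGE {μ : Fin 2 → ℝ[X] →ₗ[ℝ] ℝ}
    (hμ : ∀ i, IsFaithfulPoly (μ i)) {Ω : Set Word} (hΩ : IsProductTree Ω) (n : ℕ) (u : Word) :
    vertexSeries μ Ω u - loweringSeries μ Ω u *
      cfConvergent (fun i => jacobiBeta (μ i)) (fun i => jacobiGamma (μ i)) Ω n u ∈
        NCPowerSeries.orderGE n := by
  classical
  induction n generalizing u with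
  | zero => exact fun w hw => absurd hw (Nat.not_lt_zero _)
  | succ n ih =>
    set F := cfConvergent (fun i => jacobiBeta (μ i)) (fun i => jacobiGamma (μ i)) Ω with hF
    set D := 1 - ∑ i, cfEntry (fun i => jacobiBeta (μ i)) (fun i => jacobiGamma (μ i)) Ω i u
      (F n (i :: u)) with hD
    have hDu : IsUnit D := isUnit_one_sub_sum_cfEntry _ _ Ω u _
    have hFs : F (n + 1) u = Ring.inverse D := rfl
    -- For `(j,u) ∈ Ω`, `V_u E_{(j,u)} = β V_u z_j + L_{(j,u)} F_{(j,u)} z_j`, so the `β`-terms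
    -- cancel and only the defects at the children remain.
    have key : vertexSeries μ Ω u * D - loweringSeries μ Ω u = ∑ j : Fin 2,
        if j :: u ∈ Ω then (vertexSeries μ Ω (j :: u) -
          loweringSeries μ Ω (j :: u) * F n (j :: u)) * NCPowerSeries.var j else 0 := by
      have h1 : vertexSeries μ Ω u * D - loweringSeries μ Ω u =
          (vertexSeries μ Ω u - loweringSeries μ Ω u) - ∑ j, vertexSeries μ Ω u *
            cfEntry (fun i => jacobiBeta (μ i)) (fun i => jacobiGamma (μ i)) Ω j u
              (F n (j :: u)) := by
        rw [hD, mul_sub, mul_one, Finset.mul_sum]; abel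
      have h2 := sub_eq_iff_eq_add'.2 (vertexSeries_eq hμ hΩ u)
      rw [h1, h2, ← Finset.sum_sub_distrib]
      refine Finset.sum_congr rfl fun j _ => ?_
      rw [cfEntry_eq]
      split_ifs with hj hjj
      · rw [loweringSeries, if_pos hjj]
        simp only [mul_add, add_mul, sub_mul, NCPowerSeries.mul_smul', NCPowerSeries.smul_mul,
          mul_assoc]
        abel
      -- At a boundary child both `L_{(j,u)}` and the `γ`-term of the entry are zero.
      · rw [loweringSeries, if_neg hjj]
        simp only [add_mul, NCPowerSeries.mul_smul', NCPowerSeries.smul_mul,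
          zero_mul, add_zero, sub_zero]
        abel
      · simp
    have hmem : vertexSeries μ Ω u * D - loweringSeries μ Ω u ∈
        NCPowerSeries.orderGE (n + 1) := by
      rw [key]
      refine sum_mem fun j _ => ?_
      split_ifs
      · exact NCPowerSeries.mul_var_mem_orderGE (ih _) j
      · exact zero_mem _
    have := NCPowerSeries.mul_mem_orderGE hmem (Ring.inverse D)
    rwa [sub_mul, mul_assoc, Ring.mul_inverse_cancel _ hDu, mul_one, ← hFs] at this

theorem mainTheorem5 (μ : Fin 2 → ℝ[X] →ₗ[ℝ] ℝ) (hμ : ∀ i, IsPolyState (μ i))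
    (hfaithful : ∀ i, IsFaithfulPoly (μ i)) (Ω : Set Word) (hΩ : IsProductTree Ω) :
    HasBranchedCF (fun i => jacobiBeta (μ i)) (fun i => jacobiGamma (μ i)) Ω
      (momentSeries (productTypeState μ Ω)) := by
  refine ⟨fun n u => isUnit_one_sub_sum_cfEntry _ _ Ω u _, fun w => ?_⟩
  filter_upwards [Filter.eventually_gt_atTop w.length] with n hn
  -- At the root the lowering series is `1`, so the `n`-th truncation agrees with `M` in all degrees
  -- below `n`.
  have h := vertexSeries_sub_mem_orderGE hfaithful hΩ n [] w hn
  rw [loweringSeries, one_mul, vertexSeries_nil_word, NCPowerSeries.sub_apply] at h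
  exact (sub_eq_zero.1 h).symm
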